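/- \textbf{Conventions.} Let $X\subseteq\mathbb{R}$ carry the subspace topology. ``Countable'' means finite or countably infinite. For families $\mathcal A,\mathcal B$ of subsets of a set: $S_1(\mathcal A,\mathcal B)$ says that for every sequence $(A_n)_{n\in\mathbb N}$ of elements of $\mathcal A$ there are $b_n\in A_n$ with $\{b_n:n\in\mathbb N\}\in\mathcal B$; $S_{fin}(\mathcal A,\mathcal B)$ says that for every such sequence there are finite sets $B_n\subseteq A_n$ with $\bigcup_{n}B_n\in\mathcal B$. A family $\mathcal U$ of subsets of $X$ is a $\gamma$-cover of $X$ if $\mathcal U$ is infinite and each $x\in X$ belongs to all but finitely many elements of $\mathcal U$. Let $B_\Gamma$ (respectively $F_\Gamma$) be the set of all countable $\gamma$-covers of $X$ by Borel (respectively closed) subsets of $X$. A subset $D$ of a topological space $Z$ is sequentially dense if every point of $Z$ is the limit of a sequence of elements of $D$; $\mathcal S$ is the family of all countable sequentially dense subsets of $Z$, and $Z$ is sequentially separable if $\mathcal S\neq\emptyset$. We say that $Z$ satisfies $S_1(\mathcal S,\mathcal S)$ or $S_{fin}(\mathcal S,\mathcal S)$ if this holds for the family $\mathcal S$ of $Z$.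 Let $B(X)$ be the set of all Borel functions $X\to\mathbb R$, and $B_1(X)$ the set of all functions $X\to\mathbb R$ that are pointwise limits of sequences of continuous functions $X\to\mathbb R$, both with the topology of pointwise convergence. \textbf{Theorem.} For every set of reals $X\subseteq\mathbb R$, the following statements are equivalent: \begin{enumerate} \item $B(X)$ satisfies $S_1(\mathcal S,\mathcal S)$ and $B(X)$ is sequentially separable; \item $X$ satisfies $S_1(B_\Gamma,B_\Gamma)$; \item $B(X)$ satisfies $S_{fin}(\mathcal S,\mathcal S)$ and $B(X)$ is sequentially separable; \item $X$ satisfies $S_{fin}(B_\Gamma,B_\Gamma)$; \item $B_1(X)$ satisfies $S_1(\mathcal S,\mathcal S)$; \item $X$ satisfies $S_1(F_\Gamma,F_\Gamma)$; \item $B_1(X)$ satisfies $S_{fin}(\mathcal S,\mathcal S)$. \end{enumerate} -/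

import Mathlib

open Set Filter Topology

namespace BorelSelection

/-- The selection principle `S₁(𝒜, ℬ)` for families `𝒜`, `ℬ` of subsets of `α`. -/
def S₁ {α : Type*} (𝒜 ℬ : Set (Set α)) : Prop :=
  ∀ A : ℕ → Set α, (∀ n, A n ∈ 𝒜) →
    ∃ b : ℕ → α, (∀ n, b n ∈ A n) ∧ range b ∈ ℬ

/-- The selection principle `S_fin(𝒜, ℬ)` for families `𝒜`, `ℬ` of subsets of `α`. -/
def SFin {α : Type*} (𝒜 ℬ : Set (Set α)) : Prop :=
  ∀ A : ℕ → Set α, (∀ n, A n ∈ 𝒜) →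
    ∃ B : ℕ → Set α, (∀ n, (B n).Finite ∧ B n ⊆ A n) ∧ (⋃ n, B n) ∈ ℬ

/-- A `γ`-cover of `X`: an infinite family of subsets such that every point of `X` belongs to
all but finitely many members. -/
def IsGammaCover {X : Type*} (𝒰 : Set (Set X)) : Prop :=
  𝒰.Infinite ∧ ∀ x : X, {U ∈ 𝒰 | x ∉ U}.Finite

/-- The family of all countable Borel `γ`-covers of `X`. -/
def BorelGamma (X : Type*) [MeasurableSpace X] [TopologicalSpace X] [BorelSpace X] :
    Set (Set (Set X)) :=
  {𝒰 | 𝒰.Countable ∧ (∀ U ∈ 𝒰, MeasurableSet U) ∧ IsGammaCover 𝒰}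

/-- The family of all countable closed `γ`-covers of `X`. -/
def ClosedGamma (X : Type*) [TopologicalSpace X] : Set (Set (Set X)) :=
  {𝒰 | 𝒰.Countable ∧ (∀ U ∈ 𝒰, IsClosed U) ∧ IsGammaCover 𝒰}

/-- A set is sequentially dense if every point is the limit of a sequence from the set. -/
def SeqDense {Z : Type*} [TopologicalSpace Z] (D : Set Z) : Prop :=
  seqClosure D = univ

/-- The family `𝒮` of all countable sequentially dense subsets of `Z`. -/
def CountableSeqDense (Z : Type*) [TopologicalSpace Z] : Set (Set Z) :=
  {D | D.Countable ∧ SeqDense D}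

/-- `Z` is sequentially separable: it has a countable sequentially dense subset. -/
def SeqSeparable (Z : Type*) [TopologicalSpace Z] : Prop :=
  ∃ D : Set Z, D.Countable ∧ SeqDense D

/-- The space `B(X)` of real-valued Borel functions on `X`. As a subtype of `X → ℝ` it carries
the topology of pointwise convergence. -/
abbrev BorelFun (X : Type*) [MeasurableSpace X] [TopologicalSpace X] [BorelSpace X] : Type _ :=
  {f : X → ℝ // Measurable f}

/-- The space `B₁(X)` of functions of the first Baire class, i.e. pointwise limits of sequences of
continuous real-valued functions, with the topology of pointwise convergence. -/
abbrev BaireOneFun (X : Type*) [TopologicalSpace X] : Type _ :=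
  {f : X → ℝ // ∃ g : ℕ → X → ℝ, (∀ n, Continuous (g n)) ∧
    ∀ x, Tendsto (fun n => g n x) atTop (𝓝 (f x))}

end BorelSelection

namespace BorelSelection

/-! All seven statements reduce to `SelectsEventually`, for closed or for Borel sets. For a class
containing `univ` and closed under binary intersection, `SelectsEventually.of_sFin` and
`SelectsEventually.s₁` make it equivalent to both cover principles. The closed and Borel versions
agree because selection among closed sets forces every Borel set to be Gδ.

For function spaces, selecting from the sets where approximation errors are small gives `S₁`.
Conversely, multiplying a sequentially dense set by indicators and approximating a nonzero constant
recovers selection. The dense set needed comes from functions that depend on membership in finitely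
many basic open sets. -/

/-- From every row of a double sequence of members of `𝒞` in which each point eventually lies, one
can select a member so that each point eventually lies in the selected sets. -/
def SelectsEventually {X : Type*} (𝒞 : Set (Set X)) : Prop :=
  ∀ W : ℕ → ℕ → Set X, (∀ n k, W n k ∈ 𝒞) → (∀ n x, ∀ᶠ k in atTop, x ∈ W n k) →
    ∃ k : ℕ → ℕ, ∀ x, ∀ᶠ n in atTop, x ∈ W n (k n)

/-- The countable `γ`-covers with members in `𝒞`. -/
def GammaCovers {X : Type*} (𝒞 : Set (Set X)) : Set (Set (Set X)) :=
  {𝒰 | 𝒰.Countable ∧ (∀ U ∈ 𝒰, U ∈ 𝒞) ∧ IsGammaCover 𝒰}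

/-! ### Selection principles for γ-covers -/

section Selection

theorem S₁.sFin {α : Type*} {𝒜 ℬ : Set (Set α)} (h : S₁ 𝒜 ℬ) : SFin 𝒜 ℬ := by
  intro A hA
  obtain ⟨b, hb, hr⟩ := h A hA
  refine ⟨fun n => {b n}, fun n => ⟨finite_singleton _, singleton_subset_iff.2 (hb n)⟩, ?_⟩
  simpa only [iUnion_singleton_eq_range] using hr

variable {X : Type*}

/-- As rows decrease, a choice made in a later row also serves every earlier one. -/
theorem exists_selection_of_subsequence {V : ℕ → ℕ → Set X}
    (hV : ∀ ⦃m n⦄, m ≤ n → ∀ k, V n k ⊆ V m k) {ν κ : ℕ → ℕ} (hν : Tendsto ν atTop atTop)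
    (h : ∀ x, ∀ᶠ i in atTop, x ∈ V (ν i) (κ i)) :
    ∃ k : ℕ → ℕ, ∀ x, ∀ᶠ n in atTop, x ∈ V n (k n) := by
  have hex : ∀ n, ∃ i, n ≤ i ∧ n ≤ ν i := fun n =>
    ((eventually_ge_atTop n).and (hν.eventually_ge_atTop n)).exists
  choose i hi hνi using hex
  refine ⟨fun n => κ (i n), fun x => ?_⟩
  have hit : Tendsto i atTop atTop := tendsto_atTop_mono hi tendsto_id
  filter_upwards [hit.eventually (h x)] with n hn
  exact hV (hνi n) _ hn

theorem biInter_mem_of_inter_mem {𝒞 : Set (Set X)} (huniv : univ ∈ 𝒞)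
    (hinter : ∀ s ∈ 𝒞, ∀ t ∈ 𝒞, s ∩ t ∈ 𝒞) {W : ℕ → Set X} (hW : ∀ n, W n ∈ 𝒞) (n : ℕ) :
    (⋂ j ∈ Finset.range (n + 1), W j) ∈ 𝒞 := by
  induction Finset.range (n + 1) using Finset.induction_on with
  | empty => simpa using huniv
  | insert a s _ ih => rw [Finset.set_biInter_insert]; exact hinter _ (hW a) _ ih

theorem selectsEventually_of_antitone {𝒞 : Set (Set X)} (huniv : univ ∈ 𝒞)
    (hinter : ∀ s ∈ 𝒞, ∀ t ∈ 𝒞, s ∩ t ∈ 𝒞)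
    (h : ∀ V : ℕ → ℕ → Set X, (∀ n k, V n k ∈ 𝒞) → (∀ n x, ∀ᶠ k in atTop, x ∈ V n k) →
      (∀ ⦃m n⦄, m ≤ n → ∀ k, V n k ⊆ V m k) →
      ∃ k : ℕ → ℕ, ∀ x, ∀ᶠ n in atTop, x ∈ V n (k n)) : SelectsEventually 𝒞 := by
  intro W hW hWx
  obtain ⟨k, hk⟩ := h (fun n k => ⋂ j ∈ Finset.range (n + 1), W j k)
    (fun n k => biInter_mem_of_inter_mem huniv hinter (fun j => hW j k) n)
    (fun n x => by
      simp only [mem_iInter]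
      rw [eventually_all_finset]
      exact fun j _ => hWx j x)
    (fun m n hmn k => biInter_subset_biInter_left
      fun j hj => Finset.range_mono (Nat.succ_le_succ hmn) hj)
  refine ⟨k, fun x => (hk x).mono fun n hn => ?_⟩
  simp only [mem_iInter] at hn
  exact hn n (Finset.self_mem_range_succ n)

/-- Each value misses a point, so it is taken only finitely often. -/
theorem infinite_range_of_eventually_mem {V : ℕ → Set X} (hne : ∀ k, V k ≠ univ)
    (hV : ∀ x, ∀ᶠ k in atTop, x ∈ V k) : (range V).Infinite := by
  intro hfin
  have : ∀ᶠ k in atTop, ∀ U ∈ range V, V k ≠ U := by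
    rw [eventually_all_finite hfin]
    rintro _ ⟨j, rfl⟩
    obtain ⟨x, hx⟩ := (ne_univ_iff_exists_notMem _).1 (hne j)
    filter_upwards [hV x] with k hk he
    exact hx (he ▸ hk)
  obtain ⟨k, hk⟩ := this.exists
  exact hk _ (mem_range_self k) rfl

theorem range_mem_gammaCovers {𝒞 : Set (Set X)} {V : ℕ → Set X} (hC : ∀ k, V k ∈ 𝒞)
    (hinf : (range V).Infinite) (hV : ∀ x, ∀ᶠ k in atTop, x ∈ V k) :
    range V ∈ GammaCovers 𝒞 := by
  refine ⟨countable_range V, forall_mem_range.2 hC, hinf, fun x => ?_⟩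
  have hfin : {k | x ∉ V k}.Finite := by
    have := hV x
    rwa [← Nat.cofinite_eq_atTop, eventually_cofinite] at this
  refine (hfin.image V).subset ?_
  rintro _ ⟨⟨k, rfl⟩, hk⟩
  exact ⟨k, hk, rfl⟩

theorem SelectsEventually.of_sFin {𝒞 : Set (Set X)} (huniv : univ ∈ 𝒞)
    (hinter : ∀ s ∈ 𝒞, ∀ t ∈ 𝒞, s ∩ t ∈ 𝒞) (h : SFin (GammaCovers 𝒞) (GammaCovers 𝒞)) :
    SelectsEventually 𝒞 := by
  refine selectsEventually_of_antitone huniv hinter fun V hV hVx hanti => ?_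
  by_cases hall : ∀ n, ∃ k, V n k = univ
  · choose k hk using hall
    exact ⟨k, fun x => Eventually.of_forall fun n => by simp [hk n]⟩
  push Not at hall
  obtain ⟨N, hN⟩ := hall
  -- Rows decrease, so no row after the `N`th contains `univ` either, and each has infinite range.
  have hne : ∀ n k, V (N + n) k ≠ univ := fun n k he =>
    hN k (univ_subset_iff.1 (he ▸ hanti (Nat.le_add_right N n) k))
  obtain ⟨B, hB, -, -, hinf, hx⟩ := h (fun n => range (V (N + n))) fun n =>
    range_mem_gammaCovers (hV _) (infinite_range_of_eventually_mem (hne n) (hVx _)) (hVx _)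
  -- The union is infinite, so some member avoids the finitely many sets in the first `i`
  -- selections. Such members take each value only finitely often.
  have hex : ∀ i, ∃ n k, i ≤ n ∧ V (N + n) k ∈ (⋃ n, B n) ∧ ∀ j < i, V (N + n) k ∉ B j := by
    intro i
    have hfin : (⋃ j ∈ Iio i, B j).Finite := (finite_Iio i).biUnion fun j _ => (hB j).1
    obtain ⟨U, hU, hUi⟩ := (hinf.sdiff hfin).nonempty
    obtain ⟨n, hn⟩ := mem_iUnion.1 hU
    obtain ⟨k, rfl⟩ := (hB n).2 hn
    have hnot : ∀ j < i, V (N + n) k ∉ B j := fun j hj hm => hUi (mem_biUnion hj hm)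
    exact ⟨n, k, not_lt.1 fun hlt => hnot n hlt hn, hU, hnot⟩
  choose ν κ hν hmem hnot using hex
  refine exists_selection_of_subsequence hanti (ν := fun i => N + ν i) (κ := κ)
    (tendsto_atTop_mono (fun i => (hν i).trans (Nat.le_add_left _ _)) tendsto_id) fun x => ?_
  have : ∀ᶠ i in atTop, ∀ U ∈ {U ∈ ⋃ n, B n | x ∉ U}, V (N + ν i) (κ i) ≠ U := by
    rw [eventually_all_finite (hx x)]
    rintro U ⟨hU, -⟩
    obtain ⟨j, hj⟩ := mem_iUnion.1 hU
    filter_upwards [eventually_gt_atTop j] with i hi he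
    exact hnot i j hi (he ▸ hj)
  filter_upwards [this] with i hi
  by_contra hxi
  exact hi _ ⟨hmem i, hxi⟩ rfl

/-- Hall's condition holds because the set at the largest index of `s` already has at least `s.card`
elements. -/
theorem exists_injective_mem_of_lt_card {α : Type*} (t : ℕ → Finset α) (ht : ∀ n, n < (t n).card) :
    ∃ f : ℕ → α, Function.Injective f ∧ ∀ n, f n ∈ t n := by
  classical
  rw [← Finset.all_card_le_biUnion_card_iff_exists_injective]
  intro s
  rcases s.eq_empty_or_nonempty with rfl | hs
  · simp
  have hsub : s ⊆ Finset.range (s.max' hs + 1) := fun n hn =>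
    Finset.mem_range.2 (Nat.lt_succ_of_le (s.le_max' n hn))
  calc s.card ≤ s.max' hs + 1 := by simpa using Finset.card_le_card hsub
    _ ≤ (t (s.max' hs)).card := ht _
    _ ≤ (s.biUnion t).card :=
      Finset.card_le_card (Finset.subset_biUnion_of_mem t (s.max'_mem hs))

theorem SelectsEventually.s₁ {𝒞 : Set (Set X)} (huniv : univ ∈ 𝒞)
    (hinter : ∀ s ∈ 𝒞, ∀ t ∈ 𝒞, s ∩ t ∈ 𝒞) (h : SelectsEventually 𝒞) :
    S₁ (GammaCovers 𝒞) (GammaCovers 𝒞) := by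
  classical
  intro A hA
  have hu : ∀ n, ∃ u : ℕ → Set X, Function.Injective u ∧ ∀ k, u k ∈ A n := fun n =>
    ⟨fun k => (hA n).2.2.1.natEmbedding _ k,
      Subtype.val_injective.comp (Function.Embedding.injective _), fun k => Subtype.prop _⟩
  choose u hinj hmem using hu
  have hux : ∀ n x, ∀ᶠ k in atTop, x ∈ u n k := by
    intro n x
    rw [← Nat.cofinite_eq_atTop, eventually_cofinite]
    exact (((hA n).2.2.2 x).preimage (hinj n).injOn).subset fun k hk => ⟨hmem n k, hk⟩
  -- Selecting a window of `n + 1` distinct members at once leaves room to choose different members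
  -- in different rows, which keeps the selected family infinite.
  obtain ⟨k, hk⟩ := h (fun n k => ⋂ j ∈ Finset.range (n + 1), u n (k + j))
    (fun n k => biInter_mem_of_inter_mem huniv hinter
      (fun j => (hA n).2.1 _ (hmem n (k + j))) n)
    (fun n x => by
      simp only [mem_iInter]
      rw [eventually_all_finset]
      exact fun j _ => (tendsto_add_atTop_nat j).eventually (hux n x))
  obtain ⟨b, hbinj, hb⟩ := exists_injective_mem_of_lt_card
    (fun n => (Finset.range (n + 1)).image fun j => u n (k n + j)) fun n => by
      have hj : Function.Injective fun j => u n (k n + j) :=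
        (hinj n).comp (add_right_injective _)
      simp [Finset.card_image_of_injective _ hj]
  have hbA : ∀ n, b n ∈ A n := fun n => by
    obtain ⟨j, -, hj⟩ := Finset.mem_image.1 (hb n)
    exact hj ▸ hmem n _
  refine ⟨b, hbA, range_mem_gammaCovers (fun n => (hA n).2.1 _ (hbA n))
    (infinite_range_of_injective hbinj) fun x => ?_⟩
  filter_upwards [hk x] with n hn
  obtain ⟨j, hj, hj'⟩ := Finset.mem_image.1 (hb n)
  simp only [mem_iInter] at hn
  exact hj' ▸ hn j hj

end Selection

/-! ### From closed sets to Borel sets -/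

section Borel

variable {X : Type*} [TopologicalSpace X] [TopologicalSpace.PseudoMetrizableSpace X]

/-- Exhaust each finite intersection of the `U j` by closed sets. Selection picks one closed set per
stage so that lying in `s` means lying in almost all of them, an Fσ condition. -/
theorem SelectsEventually.isGδ_compl (h : SelectsEventually {s : Set X | IsClosed s}) {s : Set X}
    (hs : IsGδ s) : IsGδ sᶜ := by
  let _ := TopologicalSpace.pseudoMetrizableSpacePseudoMetric X
  obtain ⟨U, hU, rfl⟩ := isGδ_iff_eq_iInter_nat.1 hs
  have hT : ∀ n, IsOpen (⋂ j ∈ Finset.range (n + 1), U j) := fun n =>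
    isOpen_biInter_finset fun j _ => hU j
  choose F hFc hFs hFu hFm using fun n => (hT n).exists_iUnion_isClosed
  obtain ⟨k, hk⟩ := h (fun n k => F n k ∪ (⋂ j ∈ Finset.range (n + 1), U j)ᶜ)
    (fun n k => (hFc n k).union (hT n).isClosed_compl) (fun n x => by
      by_cases hx : x ∈ ⋂ j ∈ Finset.range (n + 1), U j
      · rw [← hFu n] at hx
        obtain ⟨j, hj⟩ := mem_iUnion.1 hx
        filter_upwards [eventually_ge_atTop j] with i hi
        exact Or.inl (hFm n hi hj)
      · exact Eventually.of_forall fun i => Or.inr hx)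
  have key : ∀ x, x ∈ ⋂ n, U n ↔ ∀ᶠ n in atTop, x ∈ F n (k n) := by
    intro x
    constructor
    · intro hx
      filter_upwards [hk x] with n hn
      refine hn.resolve_right fun hn => hn ?_
      exact mem_iInter₂.2 fun j _ => mem_iInter.1 hx j
    · intro hx
      refine mem_iInter.2 fun j => ?_
      obtain ⟨n, hn, hjn⟩ := (hx.and (eventually_ge_atTop j)).exists
      exact mem_iInter₂.1 (hFs n _ hn) j (Finset.mem_range.2 (Nat.lt_succ_of_le hjn))
  have heq : (⋂ n, U n)ᶜ = ⋂ m : ℕ, ⋃ n ∈ Ici m, (F n (k n))ᶜ := by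
    ext x
    rw [mem_compl_iff, key x, eventually_atTop]
    simp
  rw [heq]
  exact IsGδ.iInter fun m => (isOpen_biUnion fun n _ => (hFc n _).isOpen_compl).isGδ

theorem exists_monotone_isClosed_of_isGδ_compl {X : Type*} [TopologicalSpace X] {s : Set X}
    (hs : IsGδ sᶜ) : ∃ F : ℕ → Set X, (∀ n, IsClosed (F n)) ∧ Monotone F ∧ ⋃ n, F n = s := by
  obtain ⟨U, hU, he⟩ := isGδ_iff_eq_iInter_nat.1 hs
  refine ⟨accumulate fun n => (U n)ᶜ, fun n => ?_, monotone_accumulate, ?_⟩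
  · exact (finite_Iic n).isClosed_biUnion fun i _ => (hU i).isClosed_compl
  · rw [iUnion_accumulate, ← compl_iInter, ← he, compl_compl]

variable [MeasurableSpace X] [BorelSpace X]

theorem SelectsEventually.isGδ_of_measurableSet (h : SelectsEventually {s : Set X | IsClosed s})
    {s : Set X} (hs : MeasurableSet s) : IsGδ s := by
  induction s, hs using MeasurableSet.induction_on_open with
  | isOpen U hU => exact hU.isGδ
  | compl t _ ih => exact h.isGδ_compl ih
  | iUnion f _ _ ih =>
    rw [← compl_compl (⋃ i, f i), compl_iUnion]
    exact h.isGδ_compl (IsGδ.iInter fun i => h.isGδ_compl (ih i))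

theorem selectsEventually_isClosed_iff_measurableSet :
    SelectsEventually {s : Set X | IsClosed s} ↔ SelectsEventually {s : Set X | MeasurableSet s} := by
  refine ⟨fun h W hW hWx => ?_, fun h W hW => h W fun n k => IsClosed.measurableSet (hW n k)⟩
  have hT : ∀ n k, MeasurableSet (⋂ j ∈ Ici k, W n j) := fun n k =>
    MeasurableSet.biInter (to_countable _) fun j _ => hW n j
  choose F hFc hFm hFu using fun n k =>
    exists_monotone_isClosed_of_isGδ_compl (h.isGδ_of_measurableSet (hT n k).compl)
  have hFW : ∀ n k j, F n k j ⊆ ⋂ j ∈ Ici k, W n j := fun n k j =>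
    (subset_iUnion (F n k) j).trans (hFu n k).subset
  -- The bound `k ≤ j` puts column `j` inside the tail intersection from `k`, so this closed set
  -- lies in `W n j`.
  obtain ⟨k, hk⟩ := h (fun n j => ⋃ k ∈ Iic j, F n k j)
    (fun n j => (finite_Iic j).isClosed_biUnion fun k _ => hFc n k j) (fun n x => by
      obtain ⟨k, hk⟩ := eventually_atTop.1 (hWx n x)
      have hx : x ∈ ⋃ j, F n k j := by
        rw [hFu]
        exact mem_iInter₂.2 hk
      obtain ⟨j, hj⟩ := mem_iUnion.1 hx
      filter_upwards [eventually_ge_atTop j, eventually_ge_atTop k] with i hi hki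
      exact mem_biUnion (show k ∈ Iic i from hki) (hFm n k hi hj))
  refine ⟨k, fun x => (hk x).mono fun n hn => ?_⟩
  obtain ⟨j, hj, hx⟩ := mem_iUnion₂.1 hn
  exact mem_iInter₂.1 (hFW n j _ hx) _ hj

end Borel

/-! ### Functions of the first Baire class -/

section BaireOne

variable {X : Type*} [TopologicalSpace X]

/-- A function of the first Baire class: a pointwise limit of continuous functions. -/
def IsBaireOne (f : X → ℝ) : Prop :=
  ∃ g : ℕ → X → ℝ, (∀ n, Continuous (g n)) ∧ ∀ x, Tendsto (fun n => g n x) atTop (𝓝 (f x))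

theorem _root_.Continuous.isBaireOne {f : X → ℝ} (hf : Continuous f) : IsBaireOne f :=
  ⟨fun _ => f, fun _ => hf, fun _ => tendsto_const_nhds⟩

theorem IsBaireOne.continuous_comp {ι : Type*} {f : ι → X → ℝ} (hf : ∀ i, IsBaireOne (f i))
    {G : (ι → ℝ) → ℝ} (hG : Continuous G) : IsBaireOne fun x => G fun i => f i x := by
  choose g hg hlim using hf
  exact ⟨fun n x => G fun i => g i n x, fun n => hG.comp (continuous_pi fun i => hg i n),
    fun x => (hG.tendsto _).comp (tendsto_pi_nhds.2 fun i => hlim i x)⟩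

theorem IsBaireOne.mul {f g : X → ℝ} (hf : IsBaireOne f) (hg : IsBaireOne g) :
    IsBaireOne fun x => f x * g x := by
  obtain ⟨u, hu, hul⟩ := hf
  obtain ⟨v, hv, hvl⟩ := hg
  exact ⟨fun n x => u n x * v n x, fun n => (hu n).mul (hv n), fun x => (hul x).mul (hvl x)⟩

theorem IsBaireOne.measurable [MeasurableSpace X] [BorelSpace X] {f : X → ℝ} (hf : IsBaireOne f) :
    Measurable f := by
  obtain ⟨g, hg, hlim⟩ := hf
  exact measurable_of_tendsto_metrizable (fun n => (hg n).measurable) (tendsto_pi_nhds.2 hlim)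

/-- The limit lies in `U` exactly when almost all `g n x` lie in the closure of one basic set whose
closure is inside `U`. -/
theorem IsBaireOne.isGδ_compl_preimage {f : X → ℝ} (hf : IsBaireOne f) {U : Set ℝ}
    (hU : IsOpen U) : IsGδ (f ⁻¹' U)ᶜ := by
  obtain ⟨g, hg, hlim⟩ := hf
  have hB := TopologicalSpace.isBasis_countableBasis ℝ
  have heq : (f ⁻¹' U)ᶜ = ⋂ V ∈ {V ∈ TopologicalSpace.countableBasis ℝ | closure V ⊆ U},
      ⋂ N : ℕ, ⋃ n ∈ Ici N, (g n ⁻¹' closure V)ᶜ := by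
    rw [compl_eq_comm]
    ext x
    simp only [compl_iInter, compl_iUnion, compl_compl, mem_iUnion, mem_iInter, mem_preimage]
    constructor
    · rintro ⟨V, hV, N, hN⟩
      exact hV.2 (isClosed_closure.mem_of_tendsto (hlim x)
        ((eventually_ge_atTop N).mono fun n hn => hN n hn))
    · intro hx
      obtain ⟨V, hV, hxV, hVU⟩ := hB.exists_closure_subset (hU.mem_nhds hx)
      obtain ⟨N, hN⟩ := eventually_atTop.1
        ((hlim x).eventually ((hB.isOpen hV).mem_nhds hxV))
      exact ⟨V, ⟨hV, hVU⟩, N, fun n hn => subset_closure (hN n hn)⟩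
  rw [heq]
  refine IsGδ.biInter ((TopologicalSpace.countable_countableBasis ℝ).mono fun V hV => hV.1)
    fun V _ => IsGδ.iInter fun N => (isOpen_biUnion fun n _ => ?_).isGδ
  exact (isClosed_closure.preimage (hg n)).isOpen_compl

theorem isBaireOne_indicator_one [TopologicalSpace.PseudoMetrizableSpace X] {F : Set X}
    (hF : IsClosed F) : IsBaireOne (F.indicator fun _ => (1 : ℝ)) := by
  let _ := TopologicalSpace.pseudoMetrizableSpacePseudoMetric X
  refine ⟨fun n x => (hF.apprSeq n x : ℝ), fun n => by fun_prop, fun x => ?_⟩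
  have h := (NNReal.continuous_coe.tendsto _).comp
    (tendsto_pi_nhds.1 (HasOuterApproxClosed.tendsto_apprSeq hF) x)
  have he : F.indicator (fun _ => (1 : ℝ)) x = (F.indicator (fun _ => (1 : NNReal)) x : NNReal) := by
    by_cases hx : x ∈ F <;> simp [hx]
  rw [he]
  exact h

theorem IsBaireOne.indicator [TopologicalSpace.PseudoMetrizableSpace X] {f : X → ℝ}
    (hf : IsBaireOne f) {F : Set X} (hF : IsClosed F) : IsBaireOne (F.indicator f) := by
  convert (isBaireOne_indicator_one hF).mul hf using 2 with x
  by_cases hx : x ∈ F <;> simp [hx]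

end BaireOne

/-! ### A countable sequentially dense set -/

section Pattern

variable {X : Type*}

/-- The function whose value at `x` is determined by `G` from the membership of `x` in the first
`n` sets of the sequence `O`. -/
def patternFun (O : ℕ → Set X) (n : ℕ) (G : (Fin n → Prop) → ℚ) (x : X) : ℝ :=
  G fun i => x ∈ O i

variable [TopologicalSpace X]

theorem isBaireOne_patternFun [TopologicalSpace.PseudoMetrizableSpace X] {O : ℕ → Set X}
    (hO : ∀ i, IsOpen (O i)) (n : ℕ) (G : (Fin n → Prop) → ℚ) : IsBaireOne (patternFun O n G) := by
  classical
  -- Polynomial interpolation of `G` on 0-1 vectors; `t i` is the indicator of the complement of `O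
  -- i`, hence `1 - t i` where `a i` holds.
  let Ĝ : (Fin n → ℝ) → ℝ := fun t =>
    ∑ a : Fin n → Prop, (G a : ℝ) * ∏ i, if a i then 1 - t i else t i
  have hĜ : Continuous Ĝ := by
    refine continuous_finsetSum _ fun a _ => continuous_const.mul
      (continuous_finsetProd _ fun i _ => ?_)
    split_ifs <;> fun_prop
  convert IsBaireOne.continuous_comp
    (fun i : Fin n => isBaireOne_indicator_one (hO i).isClosed_compl) hĜ using 2 with x
  simp only [Ĝ, patternFun]
  rw [Finset.sum_eq_single fun i : Fin n => x ∈ O i]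
  · rw [Finset.prod_eq_one, mul_one]
    intro i _
    by_cases hx : x ∈ O i <;> simp [hx]
  · intro a _ ha
    obtain ⟨i, hi⟩ := Function.ne_iff.1 ha
    rw [Finset.prod_eq_zero (Finset.mem_univ i), mul_zero]
    by_cases hx : x ∈ O i <;> by_cases hai : a i <;> simp_all
  · simp

theorem exists_closed_cover_small_oscillation {f : X → ℝ}
    (hf : ∀ U, IsOpen U → IsGδ (f ⁻¹' U)ᶜ) :
    ∃ (F : ℕ → Set X) (c : ℕ → ℚ) (r : ℕ → ℝ), (∀ s, IsClosed (F s)) ∧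
      (∀ s, ∀ x ∈ F s, |f x - c s| < r s) ∧ ∀ x, ∀ ε > 0, ∃ s, x ∈ F s ∧ r s < ε := by
  choose F hFc _ hFu using fun (m : ℕ) (c : ℚ) => exists_monotone_isClosed_of_isGδ_compl
    (hf (Metric.ball (c : ℝ) (1 / (m + 1))) Metric.isOpen_ball)
  obtain ⟨e, he⟩ := exists_surjective_nat (ℕ × ℚ × ℕ)
  refine ⟨fun s => F (e s).1 (e s).2.1 (e s).2.2, fun s => (e s).2.1,
    fun s => 1 / ((e s).1 + 1), fun s => hFc _ _ _, fun s x hx => ?_, fun x ε hε => ?_⟩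
  · exact (hFu _ _).subset (mem_iUnion.2 ⟨_, hx⟩)
  · obtain ⟨m, hm⟩ := exists_nat_one_div_lt hε
    obtain ⟨c, hc⟩ := Rat.denseRange_cast.exists_mem_open
      (Metric.isOpen_ball (x := f x) (ε := 1 / ((m : ℝ) + 1)))
      ⟨f x, Metric.mem_ball_self (by positivity)⟩
    have hx : x ∈ ⋃ j, F m c j := by
      rw [hFu]
      exact Metric.mem_ball_comm.1 hc
    obtain ⟨j, hj⟩ := mem_iUnion.1 hx
    obtain ⟨s, hs⟩ := he (m, c, j)
    exact ⟨s, by simpa only [hs] using hj, by simpa only [hs] using hm⟩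

/-- A pattern rules out each `F s` that is disjoint from some `O i` known to contain `x`. `G` meets
the longest possible initial run of the remaining constraints. Any false constraint is eventually
ruled out, and the true ones are jointly met by rationals near `f x`. -/
theorem exists_tendsto_patternFun {O : ℕ → Set X}
    (hO : ∀ F, IsClosed F → ∀ x ∉ F, ∃ i, x ∈ O i ∧ ¬ (O i ∩ F).Nonempty) {f : X → ℝ}
    (hf : ∀ U, IsOpen U → IsGδ (f ⁻¹' U)ᶜ) :
    ∃ G : ∀ n, (Fin n → Prop) → ℚ, ∀ x,
      Tendsto (fun n => patternFun O n (G n) x) atTop (𝓝 (f x)) := by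
  classical
  obtain ⟨F, c, r, hFc, hFr, hFε⟩ := exists_closed_cover_small_oscillation hf
  let S : ∀ n, (Fin n → Prop) → Set ℕ := fun n a => {s | ∀ i, a i → (O i ∩ F s).Nonempty}
  let P : ∀ n, (Fin n → Prop) → ℕ → Prop := fun n a k =>
    ∃ q : ℚ, ∀ s < k, s ∈ S n a → |(q : ℝ) - c s| < r s
  have hP : ∀ n a, P n a (Nat.findGreatest (P n a) n) := fun n a =>
    Nat.findGreatest_spec (Nat.zero_le n) ⟨0, fun s hs => absurd hs (Nat.not_lt_zero s)⟩
  choose G hG using hP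
  refine ⟨G, fun x => Metric.tendsto_nhds.2 fun ε hε => ?_⟩
  obtain ⟨s₀, hs₀, hr⟩ := hFε x (ε / 2) (half_pos hε)
  have hmem : ∀ s, x ∈ F s → ∀ n, s ∈ S n fun i => x ∈ O i := fun s hs n i hi => ⟨x, hi, hs⟩
  have hnot : ∀ᶠ n in atTop, ∀ s ∈ Finset.range (s₀ + 1),
      (s ∈ S n fun i => x ∈ O i) → x ∈ F s := by
    rw [eventually_all_finset]
    intro s _
    by_cases hx : x ∈ F s
    · exact Eventually.of_forall fun n _ => hx
    obtain ⟨i, hi, hiF⟩ := hO (F s) (hFc s) x hx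
    filter_upwards [eventually_gt_atTop i] with n hn hs
    exact absurd (hs ⟨i, hn⟩ hi) hiF
  filter_upwards [hnot, eventually_ge_atTop (s₀ + 1)] with n hn hsn
  have hPs : P n (fun i => x ∈ O i) (s₀ + 1) := by
    have hopen : IsOpen (⋂ s ∈ {s ∈ Finset.range (s₀ + 1) | x ∈ F s},
        Metric.ball (c s : ℝ) (r s)) :=
      isOpen_biInter_finset fun s _ => Metric.isOpen_ball
    obtain ⟨q, hq⟩ := Rat.denseRange_cast.exists_mem_open hopen
      ⟨f x, mem_iInter₂.2 fun s hs => hFr s x (Finset.mem_filter.1 hs).2⟩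
    refine ⟨q, fun s hs hsS => ?_⟩
    have hs' := Finset.mem_range.2 hs
    exact mem_iInter₂.1 hq s (Finset.mem_filter.2 ⟨hs', hn s hs' hsS⟩)
  have h1 := hG n (fun i => x ∈ O i) s₀ (Nat.le_findGreatest hsn hPs) (hmem s₀ hs₀ n)
  have h2 := hFr s₀ x hs₀
  rw [abs_sub_comm] at h2
  calc dist (patternFun O n (G n) x) (f x)
      ≤ |patternFun O n (G n) x - c s₀| + |(c s₀ : ℝ) - f x| := abs_sub_le _ _ _
    _ < ε / 2 + ε / 2 := add_lt_add (h1.trans hr) (h2.trans hr)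
    _ = ε := add_halves ε

theorem exists_isOpen_seq_separating [SecondCountableTopology X] :
    ∃ O : ℕ → Set X, (∀ i, IsOpen (O i)) ∧
      ∀ F, IsClosed F → ∀ x ∉ F, ∃ i, x ∈ O i ∧ ¬ (O i ∩ F).Nonempty := by
  have hB := TopologicalSpace.isBasis_countableBasis X
  -- Adding `univ` makes the family nonempty, so that a sequence can enumerate it.
  obtain ⟨O, hO⟩ := ((TopologicalSpace.countable_countableBasis X).insert univ).exists_eq_range
    (insert_nonempty _ _)
  refine ⟨O, fun i => ?_, fun F hF x hx => ?_⟩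
  · rcases hO.symm.subset (mem_range_self i) with h | h
    · exact h ▸ isOpen_univ
    · exact hB.isOpen h
  · obtain ⟨V, hV, hxV, hVF⟩ := hB.exists_subset_of_mem_open (mem_compl hx) hF.isOpen_compl
    obtain ⟨i, rfl⟩ := hO.subset (mem_insert_of_mem _ hV)
    exact ⟨i, hxV, fun ⟨y, hy, hyF⟩ => hVF hy hyF⟩

theorem seqSeparable_of_isBaireOne_imp [TopologicalSpace.PseudoMetrizableSpace X]
    [SecondCountableTopology X] {p : (X → ℝ) → Prop} (hp : ∀ f, IsBaireOne f → p f)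
    (hGδ : ∀ f, p f → ∀ U, IsOpen U → IsGδ (f ⁻¹' U)ᶜ) : SeqSeparable {f // p f} := by
  obtain ⟨O, hOo, hO⟩ := exists_isOpen_seq_separating (X := X)
  let d : (Σ n, (Fin n → Prop) → ℚ) → {f // p f} := fun a =>
    ⟨patternFun O a.1 a.2, hp _ (isBaireOne_patternFun hOo _ _)⟩
  refine ⟨range d, countable_range d, eq_univ_of_forall fun f => ?_⟩
  obtain ⟨G, hG⟩ := exists_tendsto_patternFun hO (hGδ f.1 f.2)
  exact ⟨fun n => d ⟨n, G n⟩, fun n => mem_range_self _,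
    tendsto_subtype_rng.2 (tendsto_pi_nhds.2 hG)⟩

end Pattern

/-! ### Selection in spaces of functions -/

section FunctionSpaces

variable {X : Type*}

theorem SelectsEventually.s₁_countableSeqDense [MeasurableSpace X]
    (h : SelectsEventually {s : Set X | MeasurableSet s}) {p : (X → ℝ) → Prop}
    [Nonempty {f // p f}] (hp : ∀ f, p f → Measurable f) :
    S₁ (CountableSeqDense {f // p f}) (CountableSeqDense {f // p f}) := by
  intro A hA
  have hcl : ∀ n f, f ∈ seqClosure (A n) := fun n f => (hA n).2 ▸ mem_univ f
  have hne : (A 0).Nonempty := by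
    obtain ⟨f⟩ := ‹Nonempty {f // p f}›
    obtain ⟨g, hg, -⟩ := hcl 0 f
    exact ⟨g 0, hg 0⟩
  obtain ⟨d, hd⟩ := (hA 0).1.exists_eq_range hne
  -- Unpairing makes every `d m` a target in infinitely many rows.
  choose e heA helim using fun n => hcl n (d n.unpair.1)
  have helim' : ∀ n x, Tendsto (fun k => (e n k).1 x) atTop (𝓝 ((d n.unpair.1).1 x)) := fun n =>
    tendsto_pi_nhds.1 (tendsto_subtype_rng.1 (helim n))
  obtain ⟨k, hk⟩ := h
    (fun n k => {x | dist ((e n k).1 x) ((d n.unpair.1).1 x) < 1 / ((n : ℝ) + 1)})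
    (fun n k => measurableSet_lt ((hp _ (e n k).2).dist (hp _ (d _).2)) measurable_const)
    (fun n x => Metric.tendsto_nhds.1 (helim' n x) _ (by positivity))
  refine ⟨fun n => e n (k n), fun n => heA n _, countable_range _,
    eq_univ_of_forall fun f => ?_⟩
  obtain ⟨g, hg, hgf⟩ := hcl 0 f
  rw [hd] at hg
  choose m hm using hg
  -- Row `Nat.pair (m i) i` has target `g i` and index at least `i`, so the error tends to zero.
  refine ⟨fun i => e (Nat.pair (m i) i) (k (Nat.pair (m i) i)), fun i => mem_range_self _,
    tendsto_subtype_rng.2 (tendsto_pi_nhds.2 fun x => ?_)⟩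
  have hgx : Tendsto (fun i => (g i).1 x) atTop (𝓝 (f.1 x)) :=
    tendsto_pi_nhds.1 (tendsto_subtype_rng.1 hgf) x
  refine hgx.congr_dist ?_
  have hpair : Tendsto (fun i => Nat.pair (m i) i) atTop atTop :=
    tendsto_atTop_mono (fun i => Nat.right_le_pair _ _) tendsto_id
  refine squeeze_zero' (Eventually.of_forall fun i => dist_nonneg) ?_
    ((tendsto_one_div_add_atTop_nhds_zero_nat (𝕜 := ℝ)).comp hpair)
  filter_upwards [hpair.eventually (hk x)] with i hi
  rw [Nat.unpair_pair, hm i, dist_comm] at hi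
  exact hi.le

theorem SelectsEventually.of_sFin_countableSeqDense {𝒞 : Set (Set X)} (huniv : univ ∈ 𝒞)
    (hinter : ∀ s ∈ 𝒞, ∀ t ∈ 𝒞, s ∩ t ∈ 𝒞) {p : (X → ℝ) → Prop}
    (hconst : ∀ c : ℝ, p fun _ => c) (hind : ∀ f, p f → ∀ s ∈ 𝒞, p (s.indicator f))
    (hsep : SeqSeparable {f // p f})
    (h : SFin (CountableSeqDense {f // p f}) (CountableSeqDense {f // p f})) :
    SelectsEventually 𝒞 := by
  rcases isEmpty_or_nonempty X with hX | ⟨⟨x₀⟩⟩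
  · exact fun W _ _ => ⟨fun _ => 0, fun x => isEmptyElim x⟩
  refine selectsEventually_of_antitone huniv hinter fun V hV hVx hanti => ?_
  obtain ⟨D, hDc, hD⟩ := hsep
  let cut : ℕ → ℕ → {f // p f} → {f // p f} := fun n k f =>
    ⟨(V n k).indicator f.1, hind _ f.2 _ (hV n k)⟩
  let A : ℕ → Set {f // p f} := fun n => ⋃ k, cut n k '' D
  have hAc : ∀ n, (A n).Countable := fun n => countable_iUnion fun k => hDc.image _
  have hA : ∀ n, A n ∈ CountableSeqDense {f // p f} := by
    refine fun n => ⟨hAc n, eq_univ_of_forall fun f => ?_⟩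
    obtain ⟨g, hg, hgf⟩ : f ∈ seqClosure D := hD ▸ mem_univ f
    refine ⟨fun i => cut n i (g i), fun i => mem_iUnion.2 ⟨i, mem_image_of_mem _ (hg i)⟩,
      tendsto_subtype_rng.2 (tendsto_pi_nhds.2 fun x => ?_)⟩
    refine (tendsto_pi_nhds.1 (tendsto_subtype_rng.1 hgf) x).congr' ?_
    filter_upwards [hVx n x] with i hi
    exact (indicator_of_mem hi _).symm
  obtain ⟨B, hB, -, hBd⟩ := h A hA
  let const : ℝ → {f // p f} := fun c => ⟨fun _ => c, hconst c⟩
  have hinj : Function.Injective const := fun a b hab => congrFun (Subtype.ext_iff.1 hab) x₀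
  -- Avoiding every `A n` forces a sequence tending to `const c` out of each finite `B j`;
  -- positivity of `c` forces `x` into the cutting set, since the cut function vanishes outside it.
  obtain ⟨c, hc, hcA⟩ : ∃ c ∈ Ioi (0 : ℝ), const c ∉ ⋃ n, A n := by
    by_contra! hcon
    have hcount : (const ⁻¹' ⋃ n, A n).Countable :=
      (countable_iUnion hAc).preimage_of_injOn hinj.injOn
    have hIoo : (Ioo (0 : ℝ) 1).Countable := hcount.mono fun c hc => hcon c hc.1
    exact (Cardinal.Real.Ioo_countable_iff.1 hIoo).not_gt zero_lt_one
  obtain ⟨b, hb, hbc⟩ : const c ∈ seqClosure (⋃ n, B n) := hBd ▸ mem_univ _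
  have hex : ∀ i, ∃ n k, b i ∈ B n ∧ ∃ f ∈ D, cut n k f = b i := fun i => by
    obtain ⟨n, hn⟩ := mem_iUnion.1 (hb i)
    obtain ⟨k, hk⟩ := mem_iUnion.1 ((hB n).2 hn)
    exact ⟨n, k, hn, hk⟩
  choose ν κ hνB f _ hf using hex
  refine exists_selection_of_subsequence hanti (ν := ν) (κ := κ)
    (tendsto_atTop.2 fun N => ?_) fun x => ?_
  · have hfin : (⋃ j ∈ Iio N, B j).Finite := (finite_Iio N).biUnion fun j _ => (hB j).1
    have hev : ∀ᶠ i in atTop, ∀ g ∈ ⋃ j ∈ Iio N, B j, b i ≠ g := by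
      rw [eventually_all_finite hfin]
      intro g hg
      refine hbc.eventually_ne ?_
      rintro rfl
      obtain ⟨j, -, hj⟩ := mem_iUnion₂.1 hg
      exact hcA (mem_iUnion.2 ⟨j, (hB j).2 hj⟩)
    filter_upwards [hev] with i hi
    by_contra hlt
    exact hi _ (mem_biUnion (show ν i ∈ Iio N from not_le.1 hlt) (hνB i)) rfl
  · have hbx : Tendsto (fun i => (b i).1 x) atTop (𝓝 c) :=
      tendsto_pi_nhds.1 (tendsto_subtype_rng.1 hbc) x
    filter_upwards [hbx.eventually_ne (ne_of_gt hc)] with i hi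
    by_contra hxi
    refine hi ?_
    rw [← hf i]
    exact indicator_of_notMem hxi _

end FunctionSpaces

end BorelSelection

open BorelSelection

theorem theorem1 (X : Set ℝ) :
    List.TFAE [
      BorelSelection.S₁ (BorelSelection.CountableSeqDense (BorelSelection.BorelFun X))
          (BorelSelection.CountableSeqDense (BorelSelection.BorelFun X)) ∧
        BorelSelection.SeqSeparable (BorelSelection.BorelFun X),
      BorelSelection.S₁ (BorelSelection.BorelGamma X) (BorelSelection.BorelGamma X),
      BorelSelection.SFin (BorelSelection.CountableSeqDense (BorelSelection.BorelFun X))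
          (BorelSelection.CountableSeqDense (BorelSelection.BorelFun X)) ∧
        BorelSelection.SeqSeparable (BorelSelection.BorelFun X),
      BorelSelection.SFin (BorelSelection.BorelGamma X) (BorelSelection.BorelGamma X),
      BorelSelection.S₁ (BorelSelection.CountableSeqDense (BorelSelection.BaireOneFun X))
        (BorelSelection.CountableSeqDense (BorelSelection.BaireOneFun X)),
      BorelSelection.S₁ (BorelSelection.ClosedGamma X) (BorelSelection.ClosedGamma X),
      BorelSelection.SFin (BorelSelection.CountableSeqDense (BorelSelection.BaireOneFun X))
        (BorelSelection.CountableSeqDense (BorelSelection.BaireOneFun X))] := by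
  have hcu : univ ∈ {s : Set X | IsClosed s} := isClosed_univ
  have hci : ∀ s ∈ {s : Set X | IsClosed s}, ∀ t ∈ {s : Set X | IsClosed s},
      s ∩ t ∈ {s : Set X | IsClosed s} := fun s hs t ht => IsClosed.inter hs ht
  have hmu : univ ∈ {s : Set X | MeasurableSet s} := mem_ofPred.2 .univ
  have hmi : ∀ s ∈ {s : Set X | MeasurableSet s}, ∀ t ∈ {s : Set X | MeasurableSet s},
      s ∩ t ∈ {s : Set X | MeasurableSet s} := fun s hs t ht =>
    mem_ofPred.2 ((mem_ofPred.1 hs).inter (mem_ofPred.1 ht))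
  have hiff := selectsEventually_isClosed_iff_measurableSet (X := X)
  have hborel : Nonempty (BorelFun X) := ⟨⟨fun _ => 0, measurable_const⟩⟩
  have hbaire : Nonempty {f : X → ℝ // IsBaireOne f} := ⟨⟨fun _ => 0, continuous_const.isBaireOne⟩⟩
  tfae_have 1 → 3 := fun h => ⟨h.1.sFin, h.2⟩
  tfae_have 5 → 7 := fun h => h.sFin
  tfae_have 2 → 4 := fun h => h.sFin
  tfae_have 4 → 2 := fun h => (SelectsEventually.of_sFin hmu hmi h).s₁ hmu hmi
  tfae_have 2 → 6 := fun h => (hiff.2 (SelectsEventually.of_sFin hmu hmi h.sFin)).s₁ hcu hci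
  tfae_have 6 → 1 := fun h => by
    have hc := SelectsEventually.of_sFin hcu hci h.sFin
    exact ⟨(hiff.1 hc).s₁_countableSeqDense fun _ hf => hf,
      seqSeparable_of_isBaireOne_imp (fun _ hf => hf.measurable) fun f hf U hU =>
        hc.isGδ_of_measurableSet (hf hU.measurableSet).compl⟩
  tfae_have 3 → 2 := fun h => (hiff.1 (SelectsEventually.of_sFin_countableSeqDense hcu hci
    (fun _ => measurable_const) (fun _ hf _ hs => hf.indicator (IsClosed.measurableSet hs))
    h.2 h.1)).s₁ hmu hmi
  tfae_have 6 → 5 := fun h => (hiff.1 (SelectsEventually.of_sFin hcu hci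
    h.sFin)).s₁_countableSeqDense (p := IsBaireOne) fun _ hf => hf.measurable
  tfae_have 7 → 6 := fun h => (SelectsEventually.of_sFin_countableSeqDense (p := IsBaireOne)
    hcu hci (fun _ => continuous_const.isBaireOne) (fun _ hf _ hs => hf.indicator hs)
    (seqSeparable_of_isBaireOne_imp (fun _ hf => hf)
      fun _ hf _ hU => hf.isGδ_compl_preimage hU) h).s₁ hcu hci
  tfae_finish
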